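/- For every integer $t \ge 1$ there is a constant $C_t$, depending only on $t$, such that the following holds for every integer $d \ge 1$. Let $\mu$ denote the Lebesgue (surface) measure on the unit sphere $S^{d-1} \subset \mathbb{R}^d$, normalized so that $\mu(S^{d-1}) = 1$. 1. There is a weighted spherical $t$-design on $S^{d-1}$ with at most $C_t\, d^{t-1}$ points; that is, there are a finite set $X \subseteq S^{d-1}$ with $|X| \le C_t\, d^{t-1}$ and a weight function $w \colon X \to \mathbb{R}_{>0}$ such that $$\sum_{x \in X} w(x)\, f(x) = \int_{S^{d-1}} f \, d\mu$$ for every real polynomial $f$ in $d$ variables of total degree at most $t$. 2. There is a nonempty finite multiset $X$ of points of $S^{d-1}$ that has at most $C_t\, d^{t-1}$ distinct points and is an unweighted spherical $t$-design; that is, $$\frac{1}{|X|} \sum_{x \in X} f(x) = \int_{S^{d-1}} f \, d\mu$$ for every real polynomial $f$ in $d$ variables of total degree at most $t$, where the sum and the cardinality $|X|$ count points with multiplicity. -/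

import Mathlib

open MeasureTheory

/-- The unit sphere `S^{d-1}` of `ℝ^d` with its Euclidean norm. -/
abbrev UnitSphere (d : ℕ) : Type :=
  Metric.sphere (0 : EuclideanSpace ℝ (Fin d)) 1

/-- The Lebesgue (surface) measure on `S^{d-1}`, normalized to have total mass `1` (for `1 ≤ d`). -/
noncomputable def sphereMeasure (d : ℕ) : Measure (UnitSphere d) :=
  ((volume : Measure (EuclideanSpace ℝ (Fin d))).toSphere Set.univ)⁻¹ •
    (volume : Measure (EuclideanSpace ℝ (Fin d))).toSphere

/-- The value at a point of the sphere of a real polynomial in `d` variables. -/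
noncomputable def polyValue {d : ℕ} (f : MvPolynomial (Fin d) ℝ) (x : UnitSphere d) : ℝ :=
  MvPolynomial.eval (fun i => (x : EuclideanSpace ℝ (Fin d)) i) f

/-- The finite set `X ⊆ S^{d-1}` with the weights `w x`, `x ∈ X`, is a weighted spherical
`t`-design. The values of `w` outside `X` play no role. -/
def IsWeightedSphericalDesign {d : ℕ} (t : ℕ) (X : Finset (UnitSphere d))
    (w : UnitSphere d → ℝ) : Prop :=
  (∀ x ∈ X, 0 < w x) ∧
  ∀ f : MvPolynomial (Fin d) ℝ, f.totalDegree ≤ t →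
    ∑ x ∈ X, w x * polyValue f x = ∫ x, polyValue f x ∂(sphereMeasure d)

/-- The nonempty finite multiset `X` of points of `S^{d-1}` is an unweighted spherical `t`-design;
the sum and the cardinality count points with multiplicity. -/
def IsUnweightedSphericalDesign {d : ℕ} (t : ℕ) (X : Multiset (UnitSphere d)) : Prop :=
  X ≠ 0 ∧
  ∀ f : MvPolynomial (Fin d) ℝ, f.totalDegree ≤ t →
    (1 / (Multiset.card X : ℝ)) * (X.map (polyValue f)).sum
      = ∫ x, polyValue f x ∂(sphereMeasure d)

/-! Up to a nonzero factor depending only on the degree, the sphere has the same monomial moments as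
a product of one-dimensional Gaussians. It therefore suffices to discretize one Gaussian and to
replace its `d`-fold product by few sample vectors. For a suitable prime `p` depending only on `t`,
there are `p` integers, equally weighted, whose moments up to degree `2 * (t / 2)` are those of a
scaled Gaussian (`exists_equal_weight_quadrature`). A monomial of degree at most `t` involves at
most `t` coordinates, so the full product of these `p` values may be replaced by the rows of an
orthogonal array of strength `t`. Such an array exists with at most `p * (p * d) ^ (t - 1)` rows
(`exists_orthogonal_array`). The result is a family of integer vectors `x` with the sphere's moments
in degree `2 * s`, where `s = t / 2`. Since `‖x‖ ^ (2 * s)` is an integer, it can serve as the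
multiplicity of the two points `±x / ‖x‖`. Lower even degrees follow because `‖u‖ = 1` on the
sphere, and odd degrees by antipodal symmetry (`exists_unweighted_design_of_integer_vectors`).
Multiplicities then give the weights of part 1. -/

/-! ### Gaussian moments. -/

/-- The moments of the probability density `exp (-x ^ 2) / √π`. -/
noncomputable def gaussianMoment (j : ℕ) : ℝ :=
  (√Real.pi)⁻¹ * ∫ x : ℝ, x ^ j * Real.exp (-x ^ 2)

theorem integral_abs_pow_mul_exp_neg_sq_pos (j : ℕ) :
    0 < ∫ x : ℝ, |x| ^ j * Real.exp (-x ^ 2) := by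
  have h := integral_comp_abs (f := fun x : ℝ => x ^ j * Real.exp (-x ^ 2))
  simp only [sq_abs] at h
  rw [h]
  have h2 := integral_rpow_mul_exp_neg_mul_rpow (p := 2) (q := j) (b := 1) two_pos
    (by linarith [(Nat.cast_nonneg j : (0 : ℝ) ≤ j)]) one_pos
  have h3 : ∫ x in Set.Ioi (0 : ℝ), x ^ j * Real.exp (-x ^ 2)
      = ∫ x in Set.Ioi (0 : ℝ), x ^ (j : ℝ) * Real.exp (-1 * x ^ (2 : ℝ)) := by
    simp
  rw [h3, h2]
  have := Real.Gamma_pos_of_pos (s := ((j : ℝ) + 1) / 2) (by positivity)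
  positivity

theorem gaussianMoment_of_odd {j : ℕ} (hj : Odd j) : gaussianMoment j = 0 := by
  have h := integral_neg_eq_self (fun x : ℝ => x ^ j * Real.exp (-x ^ 2)) volume
  simp only [hj.neg_pow, neg_sq, neg_mul, integral_neg] at h
  rw [gaussianMoment, show ∫ x : ℝ, x ^ j * Real.exp (-x ^ 2) = 0 by linarith, mul_zero]

open scoped Nat in
theorem gaussianMoment_two_mul (k : ℕ) :
    gaussianMoment (2 * k) = ((2 * k - 1 : ℕ)‼ : ℝ) / 2 ^ k := by
  have h := integral_comp_abs (f := fun x : ℝ => x ^ (2 * k) * Real.exp (-x ^ 2))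
  simp only [sq_abs, (even_two_mul k).pow_abs] at h
  have h2 := integral_rpow_mul_exp_neg_mul_rpow (p := 2) (q := (2 * k : ℕ)) (b := 1) two_pos
    (by linarith [(Nat.cast_nonneg (2 * k) : (0 : ℝ) ≤ (2 * k : ℕ))]) one_pos
  have h3 : ∫ x in Set.Ioi (0 : ℝ), x ^ (2 * k) * Real.exp (-x ^ 2)
      = ∫ x in Set.Ioi (0 : ℝ), x ^ ((2 * k : ℕ) : ℝ) * Real.exp (-1 * x ^ (2 : ℝ)) := by
    simp only [Real.rpow_natCast, Real.rpow_ofNat, neg_mul, one_mul]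
  have h4 : (((2 * k : ℕ) : ℝ) + 1) / 2 = k + 1 / 2 := by push_cast; ring
  rw [gaussianMoment, h, h3, h2, h4, Real.Gamma_nat_add_half]
  have : √Real.pi ≠ 0 := (Real.sqrt_pos.2 Real.pi_pos).ne'
  simp only [Real.one_rpow]
  field_simp

theorem gaussianMoment_zero : gaussianMoment 0 = 1 := by
  simpa using gaussianMoment_two_mul 0

theorem exists_int_two_pow_mul_gaussianMoment (j : ℕ) :
    ∃ M : ℤ, (2 : ℝ) ^ j * gaussianMoment j = M := by
  rcases Nat.even_or_odd' j with ⟨k, rfl | rfl⟩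
  · refine ⟨2 ^ k * (Nat.doubleFactorial (2 * k - 1) : ℤ), ?_⟩
    rw [gaussianMoment_two_mul]
    push_cast
    rw [two_mul, pow_add]
    field_simp
  · exact ⟨0, by rw [gaussianMoment_of_odd (odd_two_mul_add_one k)]; simp⟩

/-! ### Spherical moments through Gaussian integrals. -/

/-- Polar coordinates for a positively homogeneous function with a Gaussian weight. -/
theorem integral_homogeneous_mul_exp_neg_norm_sq {E : Type*} [NormedAddCommGroup E]
    [NormedSpace ℝ E] [Nontrivial E] [FiniteDimensional ℝ E] [MeasurableSpace E] [BorelSpace E]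
    (μ : Measure E) [μ.IsAddHaarMeasure] (F : E → ℝ) (k : ℕ)
    (hF : ∀ r : ℝ, 0 < r → ∀ x, F (r • x) = r ^ k * F x) :
    ∫ x, F x * Real.exp (-‖x‖ ^ 2) ∂μ =
      (∫ u, F (u : E) ∂μ.toSphere) *
        ∫ r : Set.Ioi (0 : ℝ), (r : ℝ) ^ k * Real.exp (-(r : ℝ) ^ 2)
          ∂Measure.volumeIoiPow (Module.finrank ℝ E - 1) := by
  rw [← integral_prod_mul (fun u : Metric.sphere (0 : E) 1 => F u)
    (fun r : Set.Ioi (0 : ℝ) => (r : ℝ) ^ k * Real.exp (-(r : ℝ) ^ 2)),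
    ← μ.measurePreserving_homeomorphUnitSphereProd.integral_comp
        (Homeomorph.measurableEmbedding _),
    ← restrict_compl_singleton (μ := μ) 0,
    ← integral_subtype_comap (measurableSet_singleton _).compl
      fun x => F x * Real.exp (-‖x‖ ^ 2), restrict_compl_singleton]
  congr 1 with x
  have hx : 0 < ‖(x : E)‖ := norm_pos_iff.2 x.2
  simp only [homeomorphUnitSphereProd_apply_fst_coe, homeomorphUnitSphereProd_apply_snd_coe]
  rw [hF _ (inv_pos.2 hx), ← mul_assoc, mul_right_comm _ _ (‖(x : E)‖ ^ k), ← mul_pow,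
    inv_mul_cancel₀ hx.ne', one_pow, one_mul]

theorem integral_prod_mul_exp_neg_norm_sq {d : ℕ} (g : Fin d → ℝ → ℝ) :
    ∫ x : EuclideanSpace ℝ (Fin d), (∏ i, g i (x i)) * Real.exp (-‖x‖ ^ 2) =
      ∏ i, ∫ x : ℝ, g i x * Real.exp (-x ^ 2) := by
  rw [← integral_fintype_prod_volume_eq_prod (fun i x => g i x * Real.exp (-x ^ 2)),
    ← (PiLp.volume_preserving_toLp (Fin d)).integral_comp
      (MeasurableEquiv.toLp 2 (Fin d → ℝ)).measurableEmbedding]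
  congr 1 with x
  simp only [EuclideanSpace.norm_sq_eq, Real.norm_eq_abs, sq_abs, Finset.prod_mul_distrib,
    ← Finset.sum_neg_distrib, Real.exp_sum]

/-- Up to a factor depending on the degree only, the moments of the sphere are Gaussian. -/
theorem exists_integral_sphereMeasure_monomial (d : ℕ) (hd : 1 ≤ d) :
    ∃ κ : ℕ → ℝ, (∀ k, κ k ≠ 0) ∧ ∀ α : Fin d →₀ ℕ,
      ∫ u, ∏ i, (u : EuclideanSpace ℝ (Fin d)) i ^ α i ∂sphereMeasure d =
        κ α.degree * ∏ i, gaussianMoment (α i) := by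
  have : NeZero d := ⟨by omega⟩
  have : Nontrivial (EuclideanSpace ℝ (Fin d)) :=
    Module.nontrivial_of_finrank_pos (R := ℝ) (by simp; omega)
  set μ := (volume : Measure (EuclideanSpace ℝ (Fin d))).toSphere
  set A : ℕ → ℝ := fun k => ∫ r : Set.Ioi (0 : ℝ), (r : ℝ) ^ k * Real.exp (-(r : ℝ) ^ 2)
          ∂Measure.volumeIoiPow (Module.finrank ℝ (EuclideanSpace ℝ (Fin d)) - 1) with hA
  have hpos : ∀ x : ℕ, 0 < ∫ x_1 : ℝ, |x_1| ^ x * Real.exp (-x_1 ^ 2) :=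
    integral_abs_pow_mul_exp_neg_sq_pos
  have hA0 : ∀ k, A k ≠ 0 := by
    intro k hk
    -- The test function is `|x 0| ^ k`; the absolute value keeps its Gaussian integral positive for
    -- odd `k` too, so the radial factor cannot vanish.
    have h := integral_homogeneous_mul_exp_neg_norm_sq
      (volume : Measure (EuclideanSpace ℝ (Fin d)))
      (fun x => ∏ i, |x i| ^ ((Finsupp.single (0 : Fin d) k) i)) k (by
        intro r hr x
        simp only [PiLp.smul_apply, smul_eq_mul, abs_mul, mul_pow, Finset.prod_mul_distrib,
          abs_of_pos hr]
        rw [Finset.prod_pow_eq_pow_sum]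
        simp [Finsupp.single_apply])
    rw [integral_prod_mul_exp_neg_norm_sq
      (fun i x => |x| ^ ((Finsupp.single (0 : Fin d) k) i))] at h
    rw [show (∫ r : Set.Ioi (0 : ℝ), (r : ℝ) ^ k * Real.exp (-(r : ℝ) ^ 2)
          ∂Measure.volumeIoiPow (Module.finrank ℝ (EuclideanSpace ℝ (Fin d)) - 1)) = 0 from hk,
      mul_zero] at h
    exact (Finset.prod_pos fun i _ => hpos _).ne' h
  have hμ0 : μ Set.univ ≠ 0 := by
    rw [Ne, Measure.measure_univ_eq_zero]
    exact Measure.toSphere_ne_zero _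
  have hc : ((μ Set.univ)⁻¹).toReal ≠ 0 :=
    ENNReal.toReal_ne_zero.2 ⟨ENNReal.inv_ne_zero.2 (measure_ne_top _ _),
      ENNReal.inv_ne_top.2 hμ0⟩
  have hπ : √Real.pi ≠ 0 := (Real.sqrt_pos.2 Real.pi_pos).ne'
  refine ⟨fun k => ((μ Set.univ)⁻¹).toReal * (√Real.pi ^ d * (A k)⁻¹), fun k => ?_, fun α => ?_⟩
  · exact mul_ne_zero hc (mul_ne_zero (pow_ne_zero _ hπ) (inv_ne_zero (hA0 k)))
  · have h := integral_homogeneous_mul_exp_neg_norm_sq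
      (volume : Measure (EuclideanSpace ℝ (Fin d)))
      (fun x => ∏ i, x i ^ α i) α.degree (by
        intro r hr x
        simp only [PiLp.smul_apply, smul_eq_mul, mul_pow, Finset.prod_mul_distrib]
        rw [Finset.prod_pow_eq_pow_sum, Finsupp.degree_eq_sum])
    rw [integral_prod_mul_exp_neg_norm_sq (fun i x => x ^ α i)] at h
    rw [sphereMeasure, integral_smul_measure, smul_eq_mul]
    simp only [gaussianMoment, Finset.prod_mul_distrib, h, Finset.prod_const, Finset.card_univ,
      Fintype.card_fin]
    have h2 : √Real.pi ^ d * (√Real.pi)⁻¹ ^ d = 1 := by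
      rw [← mul_pow, mul_inv_cancel₀ hπ, one_pow]
    calc (μ Set.univ)⁻¹.toReal * ∫ u, ∏ i, (u : EuclideanSpace ℝ (Fin d)) i ^ α i ∂μ
        = (μ Set.univ)⁻¹.toReal * (∫ u, ∏ i, (u : EuclideanSpace ℝ (Fin d)) i ^ α i ∂μ) *
            (√Real.pi ^ d * (√Real.pi)⁻¹ ^ d) * ((A α.degree)⁻¹ * A α.degree) := by
          rw [h2, inv_mul_cancel₀ (hA0 _), mul_one, mul_one]
      _ = _ := by ring

/-! ### The Gaussian moment vector inside the hull of the moment curve. -/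

/-- The curve `x ↦ (x, x ^ 2, …, x ^ t)`. -/
def momentCurve (t : ℕ) (x : ℝ) : Fin t → ℝ := fun j => x ^ (j.1 + 1)

/-- The vector of the Gaussian moments of the degrees `1, …, t`. -/
noncomputable def gaussianMomentVector (t : ℕ) : Fin t → ℝ := fun j => gaussianMoment (j.1 + 1)

theorem continuous_momentCurve (t : ℕ) : Continuous (momentCurve t) := by
  unfold momentCurve
  fun_prop

theorem linearMap_momentCurve {t : ℕ} (f : (Fin t → ℝ) →ₗ[ℝ] ℝ) (x : ℝ) :
    f (momentCurve t x) = ∑ j : Fin t, f (Pi.single j 1) * x ^ (j.1 + 1) := by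
  conv_lhs => rw [pi_eq_sum_univ' (momentCurve t x), map_sum]
  refine Finset.sum_congr rfl fun j _ => ?_
  simp [momentCurve, mul_comm]

theorem linearMap_eq_zero_of_momentCurve_const {t : ℕ} (f : (Fin t → ℝ) →ₗ[ℝ] ℝ) (k : ℝ)
    (h : ∀ q : ℚ, f (momentCurve t q) = k) : f = 0 := by
  set P : Polynomial ℝ :=
    ∑ j : Fin t, Polynomial.monomial (j.1 + 1) (f (Pi.single j 1)) - Polynomial.C k with hP
  have hP0 : P = 0 := by
    refine Polynomial.eq_zero_of_infinite_isRoot P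
      ((Set.infinite_range_of_injective (Rat.cast_injective (α := ℝ))).mono ?_)
    rintro _ ⟨q, rfl⟩
    have := h q
    rw [linearMap_momentCurve] at this
    simp [hP, Polynomial.eval_finsetSum, Polynomial.eval_monomial, this]
  refine LinearMap.pi_ext' fun j => LinearMap.ext_ring ?_
  have hc := congrArg (fun Q => Polynomial.coeff Q (j.1 + 1)) hP0
  simpa [hP, Polynomial.finsetSum_coeff, Polynomial.coeff_monomial, Polynomial.coeff_C,
    Fin.val_inj] using hc

theorem integrable_pow_mul_exp_neg_sq (j : ℕ) :
    Integrable fun x : ℝ => x ^ j * Real.exp (-x ^ 2) := by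
  have h := integrable_rpow_mul_exp_neg_mul_sq (b := 1) one_pos (s := j)
    (by linarith [(Nat.cast_nonneg j : (0 : ℝ) ≤ j)])
  simpa using h

theorem integral_linearMap_momentCurve_mul_exp {t : ℕ} (f : (Fin t → ℝ) →ₗ[ℝ] ℝ) (k : ℝ) :
    Integrable (fun x : ℝ => (k - f (momentCurve t x)) * Real.exp (-x ^ 2)) ∧
    ∫ x : ℝ, (k - f (momentCurve t x)) * Real.exp (-x ^ 2) =
      √Real.pi * (k - f (gaussianMomentVector t)) := by
  have hπ : √Real.pi ≠ 0 := (Real.sqrt_pos.2 Real.pi_pos).ne'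
  have hm : ∀ j, ∫ x : ℝ, x ^ j * Real.exp (-x ^ 2) = √Real.pi * gaussianMoment j := by
    intro j
    rw [gaussianMoment, mul_inv_cancel_left₀ hπ]
  have hi : ∀ j : Fin t, Integrable
      fun x : ℝ => f (Pi.single j 1) * (x ^ (j.1 + 1) * Real.exp (-x ^ 2)) :=
    fun j => (integrable_pow_mul_exp_neg_sq _).const_mul _
  have hk : Integrable fun x : ℝ => k * (x ^ 0 * Real.exp (-x ^ 2)) :=
    (integrable_pow_mul_exp_neg_sq _).const_mul _
  have hs := integrable_finsetSum Finset.univ fun j _ => hi j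
  have he : (fun x : ℝ => (k - f (momentCurve t x)) * Real.exp (-x ^ 2)) = fun x =>
      k * (x ^ 0 * Real.exp (-x ^ 2)) -
        ∑ j : Fin t, f (Pi.single j 1) * (x ^ (j.1 + 1) * Real.exp (-x ^ 2)) := by
    ext x
    rw [linearMap_momentCurve, sub_mul, Finset.sum_mul]
    simp [mul_assoc]
  have hγ : f (gaussianMomentVector t) =
      ∑ j : Fin t, f (Pi.single j 1) * gaussianMoment (j.1 + 1) := by
    conv_lhs => rw [pi_eq_sum_univ' (gaussianMomentVector t), map_sum]
    refine Finset.sum_congr rfl fun j _ => ?_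
    simp [gaussianMomentVector, mul_comm]
  rw [he]
  refine ⟨hk.sub hs, ?_⟩
  rw [integral_sub hk hs, integral_finsetSum _ fun j _ => hi j, integral_const_mul, hm,
    gaussianMoment_zero, hγ]
  simp only [integral_const_mul, hm, mul_sub, Finset.mul_sum]
  congr 1
  · ring
  · exact Finset.sum_congr rfl fun j _ => by ring

theorem affineSpan_momentCurve_rat (t : ℕ) :
    affineSpan ℝ (Set.range fun q : ℚ => momentCurve t q) = ⊤ := by
  set S := Set.range fun q : ℚ => momentCurve t q
  have hne : S.Nonempty := Set.range_nonempty _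
  rw [← AffineSubspace.direction_eq_top_iff_of_nonempty ((affineSpan_nonempty ℝ).2 hne)]
  by_contra hlt
  obtain ⟨f, hf0, hf⟩ := Submodule.exists_le_ker_of_lt_top _ (lt_top_iff_ne_top.2 hlt)
  refine hf0 (linearMap_eq_zero_of_momentCurve_const f (f (momentCurve t (0 : ℚ))) fun q => ?_)
  have h := hf (AffineSubspace.vsub_mem_direction
    (subset_affineSpan ℝ S ⟨q, rfl⟩) (subset_affineSpan ℝ S ⟨0, rfl⟩))
  rw [LinearMap.mem_ker, vsub_eq_sub, map_sub] at h
  linarith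

/-- Otherwise a functional `f` has its maximum over the curve bounded by its value at the moment
vector, which is its Gaussian average along the curve. A nonnegative continuous function with zero
integral vanishes, so `f` is constant on the curve, hence zero, against strict separation. -/
theorem gaussianMomentVector_mem_interior (t : ℕ) :
    gaussianMomentVector t ∈
      interior (convexHull ℝ (Set.range fun q : ℚ => momentCurve t q)) := by
  set S := Set.range fun q : ℚ => momentCurve t q with hS
  by_contra hγ
  have hconv : Convex ℝ (convexHull ℝ S) := convex_convexHull ℝ S
  obtain ⟨y, hy⟩ := interior_convexHull_nonempty_iff_affineSpan_eq_top.2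
    (affineSpan_momentCurve_rat t)
  obtain ⟨f, hf⟩ := geometric_hahn_banach_open_point hconv.interior isOpen_interior hγ
  have hle : ∀ q : ℚ, f (momentCurve t q) ≤ f (gaussianMomentVector t) := by
    intro q
    have hq : momentCurve t q ∈ closure (interior (convexHull ℝ S)) := by
      rw [hconv.closure_interior_eq_closure_of_nonempty_interior ⟨y, hy⟩]
      exact subset_closure (subset_convexHull ℝ S ⟨q, rfl⟩)
    exact closure_minimal (fun a ha => (hf a ha).le)
      (isClosed_le f.continuous continuous_const) hq
  have hleR : ∀ x : ℝ, f (momentCurve t x) ≤ f (gaussianMomentVector t) := fun x =>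
    Rat.denseRange_cast.induction_on x
      (isClosed_le (f.continuous.comp (continuous_momentCurve t)) continuous_const) hle
  obtain ⟨hint, hval⟩ := integral_linearMap_momentCurve_mul_exp (f : (Fin t → ℝ) →ₗ[ℝ] ℝ)
    (f (gaussianMomentVector t))
  simp only [ContinuousLinearMap.coe_coe, sub_self, mul_zero] at hint hval
  rw [integral_eq_zero_iff_of_nonneg (fun x => mul_nonneg (sub_nonneg.2 (hleR x))
    (Real.exp_pos _).le) hint] at hval
  have hcont : Continuous fun x : ℝ =>
      (f (gaussianMomentVector t) - f (momentCurve t x)) * Real.exp (-x ^ 2) :=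
    (continuous_const.sub (f.continuous.comp (continuous_momentCurve t))).mul (by fun_prop)
  have hz := (Continuous.ae_eq_iff_eq volume hcont continuous_const).1 hval
  have hf0 := linearMap_eq_zero_of_momentCurve_const (f : (Fin t → ℝ) →ₗ[ℝ] ℝ)
    (f (gaussianMomentVector t)) fun q => by
      have h : (f (gaussianMomentVector t) - f (momentCurve t q)) * Real.exp (-(q : ℝ) ^ 2) = 0 :=
        congrFun hz (q : ℝ)
      exact (sub_eq_zero.1 ((mul_eq_zero.1 h).resolve_right (Real.exp_pos _).ne')).symm
  have hlt := hf y hy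
  have e1 : ∀ z, f z = 0 := fun z => LinearMap.congr_fun hf0 z
  rw [e1, e1] at hlt
  exact lt_irrefl _ hlt

theorem convexHull_momentCurve_mono (t : ℕ) {n m : ℕ} (hm : 0 < m) (h : n ∣ m) :
    convexHull ℝ (Set.range fun v : ℤ => momentCurve t (v / n)) ⊆
      convexHull ℝ (Set.range fun v : ℤ => momentCurve t (v / m)) := by
  refine convexHull_mono ?_
  rintro _ ⟨v, rfl⟩
  obtain ⟨k, rfl⟩ := h
  have hk : (k : ℝ) ≠ 0 := by
    rintro h0
    simp [Nat.cast_eq_zero.1 h0] at hm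
  refine ⟨v * k, ?_⟩
  push_cast
  simp only [mul_div_mul_right _ _ hk]

/-- A simplex with vertices in the rational hull already surrounds the moment vector, and its
finitely many vertices use finitely many rational nodes, which share a denominator. -/
theorem exists_gaussianMomentVector_mem_interior (t : ℕ) : ∃ n : ℕ, 0 < n ∧
    gaussianMomentVector t ∈
      interior (convexHull ℝ (Set.range fun v : ℤ => momentCurve t (v / n))) := by
  obtain ⟨b, hb, hbS⟩ := exists_mem_interior_convexHull_affineBasis
    (mem_interior_iff_mem_nhds.1 (gaussianMomentVector_mem_interior t))
  set U : Set (Fin t → ℝ) :=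
    {x | ∃ n : ℕ, 0 < n ∧ x ∈ convexHull ℝ (Set.range fun v : ℤ => momentCurve t (v / n))}
  have hU : convexHull ℝ (Set.range fun q : ℚ => momentCurve t q) ⊆ U := by
    refine convexHull_min ?_ ?_
    · rintro _ ⟨q, rfl⟩
      refine ⟨q.den, q.den_pos, subset_convexHull ℝ _ ⟨q.num, ?_⟩⟩
      simp only [Rat.cast_def q]
    · rintro x ⟨n, hn, hx⟩ y ⟨m, hm, hy⟩ a c ha hc hac
      have hnm := Nat.mul_pos hn hm
      exact ⟨n * m, hnm, convex_convexHull ℝ _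
        (convexHull_momentCurve_mono t hnm (dvd_mul_right n m) hx)
        (convexHull_momentCurve_mono t hnm (dvd_mul_left m n) hy) ha hc hac⟩
  choose n hn hbn using fun i => hU (hbS (subset_convexHull ℝ _ (Set.mem_range_self i)))
  have hpos : 0 < ∏ i, n i := Finset.prod_pos fun i _ => hn i
  refine ⟨∏ i, n i, hpos, interior_mono (convexHull_min ?_ (convex_convexHull ℝ _)) hb⟩
  rintro _ ⟨i, rfl⟩
  exact convexHull_momentCurve_mono t hpos (Finset.dvd_prod_of_mem n (Finset.mem_univ i)) (hbn i)

/-! ### Quadrature with integer nodes. -/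

/-- A quadrature formula for a scaled Gaussian, with nodes at multiples of `L` and with the
nodes `0, …, t` of equal positive weight. -/
theorem exists_integer_quadrature (t L : ℕ) (hL : 0 < L) :
    ∃ (σ : ℕ) (ι : Type) (_ : Fintype ι) (w : ι → ℝ) (v : ι → ℤ) (ε : ℝ),
      0 < σ ∧ L ∣ σ ∧ 0 < ε ∧ (∀ i, 0 ≤ w i) ∧ (∀ i, (L : ℤ) ∣ v i) ∧
      ∀ j ≤ t, ∑ i, w i * (v i : ℝ) ^ j + ε * ∑ k ∈ Finset.range (t + 1), (k : ℝ) ^ j =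
        (σ : ℝ) ^ j * gaussianMoment j := by
  obtain ⟨n, hn, hγ⟩ := exists_gaussianMomentVector_mem_interior t
  have hσ : ((L * n : ℕ) : ℝ) ≠ 0 := by positivity
  -- Scaling by `σ = L * n` turns the nodes `v / n` into multiples of `L`, and the nodes `k / (L *
  -- n)` into `0, …, t`. Reserving a small mass `ε` for each of the latter moves the remaining
  -- target only slightly, so it stays in the open interior.
  set c : Fin t → ℝ := ∑ k ∈ Finset.range (t + 1), momentCurve t (k / (L * n : ℕ)) with hc
  have hcont : ContinuousAt
      (fun ε : ℝ => (1 - ε * (t + 1))⁻¹ • (gaussianMomentVector t - ε • c)) 0 := by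
    have h1 : ContinuousAt (fun ε : ℝ => 1 - ε * (t + 1)) 0 := by fun_prop
    have h2 : ContinuousAt (fun ε : ℝ => gaussianMomentVector t - ε • c) 0 := by fun_prop
    exact (h1.inv₀ (by simp)).smul h2
  have hev := hcont.eventually_mem (s := interior (convexHull ℝ (Set.range fun v : ℤ =>
    momentCurve t (v / n)))) (isOpen_interior.mem_nhds (by simpa using hγ))
  have hsmall : ∀ᶠ ε : ℝ in nhds 0, ε * (t + 1) < 1 :=
    ContinuousAt.eventually_lt (by fun_prop) continuousAt_const (by simp)
  obtain ⟨ε, ⟨hε1, hε2⟩, hε⟩ :=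
    (((hev.and hsmall).filter_mono nhdsWithin_le_nhds).and
      (self_mem_nhdsWithin (s := Set.Ioi (0 : ℝ)))).exists
  obtain ⟨ι, hι, w, z, hw, hw1, hz, hsum⟩ :=
    mem_convexHull_iff_exists_fintype.1 (interior_subset hε1)
  choose v hv using hz
  have hε3 : 0 < 1 - ε * (t + 1) := by linarith
  refine ⟨L * n, ι, hι, fun i => (1 - ε * (t + 1)) * w i, fun i => L * v i, ε,
    Nat.mul_pos hL hn, dvd_mul_right _ _, hε, fun i => mul_nonneg hε3.le (hw i),
    fun i => dvd_mul_right _ _, fun j hj => ?_⟩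
  rcases j with _ | j
  · simp only [pow_zero, mul_one, ← Finset.mul_sum, hw1, gaussianMoment_zero, Finset.sum_const,
      Finset.card_range, nsmul_eq_mul]
    push_cast
    ring
  · have hsj := congrFun hsum ⟨j, hj⟩
    simp only [Finset.sum_apply, Pi.smul_apply, smul_eq_mul, Pi.sub_apply, hc, ← hv,
      momentCurve, gaussianMomentVector] at hsj
    rw [eq_inv_mul_iff_mul_eq₀ hε3.ne'] at hsj
    have hL0 : (L : ℝ) ≠ 0 := by positivity
    have hn0 : (n : ℝ) ≠ 0 := by positivity
    calc ∑ i, (1 - ε * (t + 1)) * w i * ((L * v i : ℤ) : ℝ) ^ (j + 1) +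
          ε * ∑ k ∈ Finset.range (t + 1), (k : ℝ) ^ (j + 1)
        = ((L * n : ℕ) : ℝ) ^ (j + 1) * ((1 - ε * (t + 1)) * ∑ i, w i * (v i / n : ℝ) ^ (j + 1) +
          ε * ∑ k ∈ Finset.range (t + 1), ((k : ℝ) / (L * n : ℕ)) ^ (j + 1)) := by
          rw [mul_add (((L * n : ℕ) : ℝ) ^ (j + 1))]
          simp only [Finset.mul_sum]
          congr 1
          · refine Finset.sum_congr rfl fun i _ => ?_
            push_cast
            rw [div_pow, mul_pow, mul_pow]
            field_simp
          · refine Finset.sum_congr rfl fun k _ => ?_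
            rw [div_pow]
            field_simp
      _ = _ := by rw [hsj]; ring

/-- The coefficients `a i k` of the Lagrange basis at the nodes `0, …, t`, with a common
denominator `L` of the nonconstant ones. -/
theorem exists_lagrange_coefficients (t : ℕ) : ∃ (L : ℕ) (a : ℕ → ℕ → ℝ), 0 < L ∧
    (∀ j ≤ t, ∀ x : ℝ, ∑ i ∈ Finset.range (t + 1),
      (∑ k ∈ Finset.range (t + 1), a i k * x ^ k) * (i : ℝ) ^ j = x ^ j) ∧
    (∀ i ∈ Finset.range (t + 1), ∀ i' ∈ Finset.range (t + 1),
      ∑ k ∈ Finset.range (t + 1), a i k * (i' : ℝ) ^ k = if i = i' then 1 else 0) ∧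
    (∀ i ∈ Finset.range (t + 1), ∀ x : ℕ → ℝ, x 0 = 1 → (∀ k, ∃ b : ℤ, x (k + 1) = L * b) →
      ∃ B : ℤ, ∑ k ∈ Finset.range (t + 1), a i k * x k = B) := by
  set s := Finset.range (t + 1) with hs
  set ℓ : ℕ → Polynomial ℚ := fun i => Lagrange.basis s (fun i : ℕ => (i : ℚ)) i with hℓ
  have hinj : Set.InjOn (fun i : ℕ => (i : ℚ)) s := Nat.cast_injective.injOn
  have hdeg : ∀ i ∈ s, (ℓ i).natDegree < t + 1 := by
    intro i hi
    have := Polynomial.natDegree_eq_of_degree_eq_some (Lagrange.degree_basis hinj hi)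
    have hc : s.card = t + 1 := Finset.card_range _
    change (Lagrange.basis s (fun i : ℕ => (i : ℚ)) i).natDegree < t + 1
    omega
  have heval : ∀ i ∈ s, ∀ x : ℝ, ∑ k ∈ s, ((ℓ i).coeff k : ℝ) * x ^ k =
      ((ℓ i).map (algebraMap ℚ ℝ)).eval x := by
    intro i hi x
    rw [Polynomial.eval_eq_sum_range' (n := t + 1)]
    · simp [hs]
    · rw [Polynomial.natDegree_map]
      exact hdeg i hi
  have hB : ∀ i ∈ s, ∀ i' ∈ s,
      ∑ k ∈ s, ((ℓ i).coeff k : ℝ) * (i' : ℝ) ^ k = if i = i' then 1 else 0 := by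
    intro i hi i' hi'
    rw [heval i hi, show (i' : ℝ) = algebraMap ℚ ℝ (i' : ℚ) by simp, Polynomial.eval_map_algebraMap,
      Polynomial.aeval_algebraMap_apply, Polynomial.coe_aeval_eq_eval]
    split_ifs with h
    · subst h
      simp only [hℓ]
      rw [Lagrange.eval_basis_self hinj hi, map_one]
    · simp only [hℓ]
      rw [Lagrange.eval_basis_of_ne (v := fun i : ℕ => (i : ℚ)) h hi', map_zero]
  refine ⟨∏ i ∈ s, ∏ k ∈ s, ((ℓ i).coeff k).den, fun i k => ((ℓ i).coeff k : ℝ),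
    Finset.prod_pos fun i _ => Finset.prod_pos fun k _ => Rat.den_pos _, ?_, hB, ?_⟩
  · intro j hj x
    have hX : (Polynomial.X ^ j : Polynomial ℚ) = ∑ i ∈ s, Polynomial.C ((i : ℚ) ^ j) * ℓ i := by
      rw [Lagrange.eq_interpolate (f := Polynomial.X ^ j) hinj, Lagrange.interpolate_apply]
      · simp [hℓ]
      · rw [Polynomial.degree_X_pow, hs, Finset.card_range]
        exact_mod_cast Nat.lt_succ_of_le hj
    have h := congrArg (fun P => (P.map (algebraMap ℚ ℝ)).eval x) hX
    simp only [Polynomial.map_pow, Polynomial.map_X, Polynomial.eval_pow, Polynomial.eval_X,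
      Polynomial.map_sum, Polynomial.eval_finsetSum, Polynomial.map_mul, Polynomial.map_C,
      Polynomial.eval_mul, Polynomial.eval_C] at h
    rw [h]
    refine Finset.sum_congr rfl fun i hi => ?_
    rw [heval i hi, mul_comm]
    simp
  -- `x` need not be a sequence of powers, because this is also applied to the scaled Gaussian
  -- moments. The constant coefficient is the value of the basis polynomial at `0`, which is `0` or
  -- `1`, so only the others need the denominator `L`.
  · intro i hi x hx0 hx
    choose b hb using hx
    have hterm : ∀ k ∈ s, ∃ B : ℤ, ((ℓ i).coeff k : ℝ) * x k = B := by
      intro k hk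
      rcases k with _ | k
      · have h0 := hB i hi 0 (by simp [hs])
        simp only [Nat.cast_zero] at h0
        rw [Finset.sum_eq_single 0 (by intro k _ hk; simp [hk]) (by simp [hs])] at h0
        rw [hx0, ← pow_zero (0 : ℝ), h0]
        exact ⟨if i = 0 then 1 else 0, by split_ifs <;> simp⟩
      · obtain ⟨c, hc⟩ := (Finset.dvd_prod_of_mem (fun k => ((ℓ i).coeff k).den) hk).trans
          (Finset.dvd_prod_of_mem (fun i => ∏ k ∈ s, ((ℓ i).coeff k).den) hi)
        refine ⟨((ℓ i).coeff (k + 1)).num * c * b k, ?_⟩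
        rw [hb, hc]
        have hq : ((ℓ i).coeff (k + 1) : ℝ) * (((ℓ i).coeff (k + 1)).den : ℝ) =
            (((ℓ i).coeff (k + 1)).num : ℝ) := by exact_mod_cast Rat.mul_den_eq_num _
        push_cast
        rw [← hq]
        ring
    choose! B hB' using hterm
    exact ⟨∑ k ∈ s, B k, by rw [Finset.sum_congr rfl hB']; push_cast; rfl⟩

/-- Equal-weight integer quadrature for a scaled Gaussian, with any large number of nodes. -/
theorem exists_equal_weight_quadrature (t : ℕ) : ∃ (σ N : ℕ), 0 < σ ∧
    ∀ p ≥ N, ∃ g : Fin p → ℤ, ∀ j ≤ t,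
      ∑ b, (g b : ℝ) ^ j = p * ((σ : ℝ) ^ j * gaussianMoment j) := by
  obtain ⟨L, a, hL, hexact, hdelta, hint⟩ := exists_lagrange_coefficients t
  -- The factor `2` clears the powers of two in the denominators of the Gaussian moments; `L` clears
  -- the Lagrange coefficients.
  obtain ⟨σ, ι, _, w, v, ε, hσ, hLσ, hε, hw, hv, hq⟩ :=
    exists_integer_quadrature t (2 * L) (by positivity)
  set s := Finset.range (t + 1) with hs
  set ℓ : ℕ → ℝ → ℝ := fun k x => ∑ m ∈ s, a k m * x ^ m with hℓ
  set B : ℝ := ∑ i, ∑ k ∈ s, |ℓ k (v i)| with hB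
  obtain ⟨N, hN⟩ := exists_nat_ge (B / ε)
  refine ⟨σ, N, hσ, fun p hp => ?_⟩
  have hpε : B ≤ p * ε := by
    rw [div_le_iff₀ hε] at hN
    exact hN.trans (mul_le_mul_of_nonneg_right (by exact_mod_cast hp) hε.le)
  -- The weights `p * w i` are rounded down, and each lost fraction is moved to the nodes `0, …, t`
  -- by Lagrange interpolation, which is exact up to degree `t`.
  set n : ι → ℕ := fun i => ⌊p * w i⌋₊ with hn
  set fr : ι → ℝ := fun i => p * w i - n i with hfr
  have hfr0 : ∀ i, 0 ≤ fr i := fun i =>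
    sub_nonneg.2 (Nat.floor_le (mul_nonneg (Nat.cast_nonneg p) (hw i)))
  have hfr1 : ∀ i, fr i ≤ 1 := fun i => by
    have := Nat.lt_floor_add_one ((p : ℝ) * w i)
    simp only [hfr, hn]
    linarith
  -- The new weight at `k` is nonnegative because the reserve `p * ε` dominates the corrections. It
  -- is an integer because the quadrature applied to `ℓ k` gives an integer `M`, as are the values
  -- `ℓ k (v i)`.
  have hu : ∀ k ∈ s, ∃ u : ℕ, p * ε + ∑ i, fr i * ℓ k (v i) = u := by
    intro k hk
    have hnonneg : 0 ≤ p * ε + ∑ i, fr i * ℓ k (v i) := by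
      have h1 : -B ≤ ∑ i, fr i * ℓ k (v i) := by
        rw [hB, ← Finset.sum_neg_distrib]
        refine Finset.sum_le_sum fun i _ => ?_
        have h2 : |ℓ k (v i)| ≤ ∑ k ∈ s, |ℓ k (v i)| :=
          Finset.single_le_sum (f := fun k => |ℓ k (v i)|) (fun _ _ => abs_nonneg _) hk
        have h3 : |fr i * ℓ k (v i)| ≤ |ℓ k (v i)| := by
          rw [abs_mul, abs_of_nonneg (hfr0 i)]
          exact mul_le_of_le_one_left (abs_nonneg _) (hfr1 i)
        linarith [neg_abs_le (fr i * ℓ k (v i))]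
      linarith
    have hℓint : ∀ i, ∃ c : ℤ, ℓ k (v i) = c := fun i =>
      hint k hk (fun m => (v i : ℝ) ^ m) (pow_zero _) fun m => by
        obtain ⟨c, hc⟩ := hv i
        refine ⟨2 * c * v i ^ m, ?_⟩
        rw [hc]
        push_cast
        ring
    choose c hc using hℓint
    obtain ⟨M, hM⟩ := hint k hk (fun m => (σ : ℝ) ^ m * gaussianMoment m)
      (by simp [gaussianMoment_zero]) fun m => by
        obtain ⟨c, rfl⟩ := hLσ
        obtain ⟨M, hM⟩ := exists_int_two_pow_mul_gaussianMoment (m + 1)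
        refine ⟨L ^ m * c ^ (m + 1) * M, ?_⟩
        push_cast
        rw [← hM]
        ring
    have hΛ : ∑ i, w i * ℓ k (v i) + ε = M := by
      rw [← hM]
      have : ∀ m ∈ s, a k m * ((σ : ℝ) ^ m * gaussianMoment m) =
          ∑ i, w i * (a k m * (v i : ℝ) ^ m) + ε * ∑ k' ∈ s, a k m * (k' : ℝ) ^ m := by
        intro m hm
        rw [← hq m (Nat.lt_succ_iff.1 (Finset.mem_range.1 hm)), mul_add]
        simp only [Finset.mul_sum]
        congr 1
        · exact Finset.sum_congr rfl fun i _ => by ring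
        · exact Finset.sum_congr rfl fun i _ => by ring
      rw [Finset.sum_congr rfl this, Finset.sum_add_distrib, Finset.sum_comm, ← Finset.mul_sum,
        Finset.sum_comm (s := s) (t := s)]
      simp only [← Finset.mul_sum]
      rw [Finset.sum_congr rfl fun k' hk' => hdelta k hk k' hk']
      simp [hk, hℓ]
    have hz : p * ε + ∑ i, fr i * ℓ k (v i) = ((p * M - ∑ i, n i * c i : ℤ) : ℝ) := by
      push_cast
      rw [← hΛ, mul_add, Finset.mul_sum]
      simp only [hfr, sub_mul, Finset.sum_sub_distrib, ← hc]
      simp only [mul_assoc]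
      ring
    rw [hz] at hnonneg ⊢
    obtain ⟨u, hu⟩ := Int.eq_ofNat_of_zero_le (Int.cast_nonneg_iff.1 hnonneg)
    exact ⟨u, by rw [hu]; simp⟩
  choose! u hu using hu
  have hmom : ∀ j ≤ t, ∑ i, (n i : ℝ) * (v i : ℝ) ^ j + ∑ k ∈ s, (u k : ℝ) * (k : ℝ) ^ j =
      p * ((σ : ℝ) ^ j * gaussianMoment j) := by
    intro j hj
    have h1 : ∑ k ∈ s, (u k : ℝ) * (k : ℝ) ^ j =
        p * (ε * ∑ k ∈ s, (k : ℝ) ^ j) + ∑ i, fr i * (v i : ℝ) ^ j := by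
      rw [Finset.sum_congr rfl fun k hk => by rw [← hu k hk]]
      simp only [add_mul, Finset.sum_add_distrib, Finset.sum_mul]
      rw [Finset.sum_comm]
      congr 1
      · rw [Finset.mul_sum, Finset.mul_sum]
        exact Finset.sum_congr rfl fun k _ => by ring
      · refine Finset.sum_congr rfl fun i _ => ?_
        rw [← hexact j hj (v i), Finset.mul_sum]
        exact Finset.sum_congr rfl fun k _ => by ring
    rw [h1, ← hq j hj, mul_add, Finset.mul_sum (s := Finset.univ)]
    simp only [hfr, sub_mul, Finset.sum_sub_distrib, mul_assoc]
    ring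
  -- Degree `0` of `hmom` counts the nodes.
  have hcard : Fintype.card ((Σ i : ι, Fin (n i)) ⊕ (Σ k : s, Fin (u k))) = p := by
    have h0 := hmom 0 (Nat.zero_le t)
    simp only [pow_zero, mul_one, gaussianMoment_zero] at h0
    rw [Fintype.card_sum, Fintype.card_sigma, Fintype.card_sigma]
    simp only [Fintype.card_fin]
    rw [Finset.sum_coe_sort s (fun k => u k)]
    exact_mod_cast h0
  let e := Fintype.equivFinOfCardEq hcard
  refine ⟨fun b => Sum.elim (fun y => v y.1) (fun y => (y.1 : ℕ)) (e.symm b), fun j hj => ?_⟩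
  rw [e.symm.sum_comp (fun b => ((Sum.elim (fun y : Σ i : ι, Fin (n i) => v y.1)
    (fun y : Σ k : s, Fin (u k) => ((y.1 : ℕ) : ℤ)) b : ℤ) : ℝ) ^ j), Fintype.sum_sum_type,
    Fintype.sum_sigma, Fintype.sum_sigma, ← hmom j hj, ← Finset.sum_coe_sort s]
  simp

/-! ### Orthogonal arrays from traces of polynomials. -/

theorem card_mul_sum_comp_of_surjective {G H : Type*} [AddGroup G] [AddGroup H] [Fintype G]
    [Fintype H] (Φ : G →+ H) (hΦ : Function.Surjective Φ) (F : H → ℝ) :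
    (Fintype.card H : ℝ) * ∑ g, F (Φ g) = Fintype.card G * ∑ h, F h := by
  classical
  have hfib : ∀ h : H, (Finset.univ.filter fun g => Φ g = h).card =
      (Finset.univ.filter fun g => Φ g = 0).card := fun h =>
    AddMonoidHom.card_fiber_eq_of_mem_range Φ (hΦ h) (hΦ 0)
  set K := (Finset.univ.filter fun g => Φ g = 0).card
  have hsum : ∀ F : H → ℝ, ∑ g, F (Φ g) = K * ∑ h, F h := by
    intro F
    rw [← Finset.sum_fiberwise_of_maps_to (s := Finset.univ) (t := Finset.univ) (g := Φ)
      (fun _ _ => Finset.mem_univ _), Finset.mul_sum]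
    refine Finset.sum_congr rfl fun h _ => ?_
    rw [Finset.sum_congr rfl fun g hg => by rw [(Finset.mem_filter.1 hg).2], Finset.sum_const,
      hfib h, nsmul_eq_mul]
  have hcard := hsum fun _ => 1
  simp only [Finset.sum_const, Finset.card_univ, nsmul_eq_mul, mul_one] at hcard
  rw [hsum, hcard]
  ring

/-- An orthogonal array of strength `n + 1` with `d` columns over `ZMod p`. -/
theorem exists_orthogonal_array (p : ℕ) [Fact p.Prime] (n d : ℕ) (hd : 1 ≤ d) :
    ∃ (R : Type) (_ : Fintype R) (h : R → Fin d → ZMod p),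
      0 < Fintype.card R ∧ Fintype.card R ≤ p * (p * d) ^ n ∧
      ∀ (S : Finset (Fin d)), S.card ≤ n + 1 → ∀ φ : Fin d → ZMod p → ℝ, (∀ i ∉ S, φ i = 1) →
        ∑ r, ∏ i, φ i (h r i) = Fintype.card R * ∏ i, ((∑ b, φ i b) / p) := by
  classical
  have hp : p.Prime := Fact.out
  have hp0 : (p : ℝ) ≠ 0 := by exact_mod_cast hp.ne_zero
  -- With this choice `d < p ^ m ≤ p * d`, so the field has room for `d` distinct points.
  set m := Nat.log p d + 1 with hm
  let F := GaloisField p m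
  have : Fintype F := Fintype.ofFinite F
  have hcardF : Fintype.card F = p ^ m := by
    rw [← Nat.card_eq_fintype_card]
    exact GaloisField.card p m (Nat.succ_ne_zero _)
  have hdF : Fintype.card (Fin d) ≤ Fintype.card F := by
    rw [Fintype.card_fin, hcardF]
    exact (Nat.lt_pow_succ_log_self hp.one_lt d).le
  obtain ⟨x⟩ := Function.Embedding.nonempty_of_card_le hdF
  have hT := Algebra.trace_surjective (ZMod p) F
  set T := Algebra.trace (ZMod p) F
  -- Entries are traces of polynomials of degree at most `n` at the points `x i`. Only the trace of
  -- the constant term matters, so it ranges over `ZMod p` rather than `F`; this saves the last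
  -- factor of `d`.
  let h : ZMod p × (Fin n → F) → Fin d → ZMod p := fun c i =>
    c.1 + ∑ j : Fin n, T (c.2 j * x i ^ (j.1 + 1))
  refine ⟨ZMod p × (Fin n → F), inferInstance, h, Fintype.card_pos, ?_, fun S hS φ hφ => ?_⟩
  · simp only [Fintype.card_prod, ZMod.card, Fintype.card_fun, Fintype.card_fin, hcardF]
    gcongr
    rw [hm, pow_succ, mul_comm]
    gcongr
    exact Nat.pow_log_le_self p (by omega)
  · let Φ : ZMod p × (Fin n → F) →+ (S → ZMod p) :=
      { toFun := fun c i => h c i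
        map_zero' := by ext i; simp [h]
        map_add' := fun c c' => by
          ext i
          simp only [h, Prod.fst_add, Prod.snd_add, Pi.add_apply, add_mul, map_add,
            Finset.sum_add_distrib]
          ring }
    -- Prescribed entries in at most `n + 1` columns are lifted through the trace and interpolated
    -- by a polynomial of degree at most `n`.
    have hsurj : Function.Surjective Φ := by
      intro y
      choose Y hY using fun i : Fin d => hT (if hi : i ∈ S then y ⟨i, hi⟩ else 0)
      set P := Lagrange.interpolate S x Y with hP
      have hdeg : P.natDegree < n + 1 := by
        rcases eq_or_ne P 0 with h0 | h0
        · simp [h0]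
        · refine (Polynomial.natDegree_lt_iff_degree_lt h0).2 ?_
          exact (Lagrange.degree_interpolate_lt Y x.injective.injOn).trans_le
            (by exact_mod_cast hS)
      refine ⟨(T (P.coeff 0), fun j => P.coeff (j + 1)), ?_⟩
      ext i
      have he : P.eval (x i) = Y i :=
        Lagrange.eval_interpolate_at_node Y x.injective.injOn i.2
      rw [Polynomial.eval_eq_sum_range' hdeg, Finset.sum_range_succ'] at he
      have h2 := hY i
      rw [← he] at h2
      simp only [Finset.coe_mem, dif_pos, map_add, map_sum, pow_zero, mul_one] at h2
      rw [← h2, ← Fin.sum_univ_eq_sum_range (fun k => T (P.coeff (k + 1) * x i ^ (k + 1))) n,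
        add_comm]
      rfl
    have hkey := card_mul_sum_comp_of_surjective Φ hsurj fun y => ∏ i : S, φ i (y i)
    have hprod : ∏ i, ((∑ b, φ i b) / p) = (∏ i : S, ∑ b, φ i b) / (p : ℝ) ^ S.card := by
      rw [← Finset.prod_subset (Finset.subset_univ S), Finset.prod_div_distrib,
        Finset.prod_const, Finset.prod_coe_sort S (fun i => ∑ b, φ i b)]
      intro i _ hi
      simp [hφ i hi, hp0]
    have hleft : ∀ r, ∏ i, φ i (h r i) = ∏ i : S, φ i (Φ r i) := by
      intro r
      rw [← Finset.prod_subset (Finset.subset_univ S), ← Finset.prod_coe_sort S]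
      · rfl
      · intro i _ hi
        simp [hφ i hi]
    rw [hprod, Fintype.prod_sum, mul_div_assoc', eq_div_iff (pow_ne_zero _ hp0)]
    simp only [hleft]
    rw [← hkey, mul_comm]
    simp

/-! ### From integer vectors to spherical designs. -/

theorem isProbabilityMeasure_sphereMeasure (d : ℕ) (hd : 1 ≤ d) :
    IsProbabilityMeasure (sphereMeasure d) := by
  have : Nontrivial (EuclideanSpace ℝ (Fin d)) :=
    Module.nontrivial_of_finrank_pos (R := ℝ) (by simp; omega)
  refine ⟨?_⟩
  rw [sphereMeasure, Measure.smul_apply, smul_eq_mul]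
  refine ENNReal.inv_mul_cancel ?_ (measure_ne_top _ _)
  rw [Ne, Measure.measure_univ_eq_zero]
  exact Measure.toSphere_ne_zero _

theorem polyValue_eq_sum {d : ℕ} (f : MvPolynomial (Fin d) ℝ) (u : UnitSphere d) :
    polyValue f u = ∑ α ∈ f.support,
      f.coeff α * ∏ i, (u : EuclideanSpace ℝ (Fin d)) i ^ α i :=
  MvPolynomial.eval_eq' _ _

theorem continuous_sphere_monomial {d : ℕ} (α : Fin d →₀ ℕ) :
    Continuous fun u : UnitSphere d => ∏ i, (u : EuclideanSpace ℝ (Fin d)) i ^ α i := by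
  fun_prop

theorem integral_polyValue {d : ℕ} (hd : 1 ≤ d) (f : MvPolynomial (Fin d) ℝ) :
    ∫ u, polyValue f u ∂sphereMeasure d = ∑ α ∈ f.support,
      f.coeff α * ∫ u, ∏ i, (u : EuclideanSpace ℝ (Fin d)) i ^ α i ∂sphereMeasure d := by
  have := isProbabilityMeasure_sphereMeasure d hd
  simp only [polyValue_eq_sum]
  rw [integral_finsetSum]
  · simp only [integral_const_mul]
  · intro α _
    exact ((continuous_sphere_monomial α).integrable_of_hasCompactSupport
      (HasCompactSupport.of_compactSpace _)).const_mul _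

theorem exists_unitSphere_smul {d : ℕ} (hd : 1 ≤ d) (x : Fin d → ℝ) :
    ∃ u : UnitSphere d, ∀ i, x i = √(∑ i, x i ^ 2) * (u : EuclideanSpace ℝ (Fin d)) i := by
  have : Nontrivial (EuclideanSpace ℝ (Fin d)) :=
    Module.nontrivial_of_finrank_pos (R := ℝ) (by simp; omega)
  rcases eq_or_ne (WithLp.toLp 2 x) 0 with h | h
  · obtain ⟨u, hu⟩ := (NormedSpace.sphere_nonempty (E := EuclideanSpace ℝ (Fin d)) (x := 0)).2
      zero_le_one
    have hx : x = 0 := by simpa using h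
    exact ⟨⟨u, hu⟩, by simp [hx]⟩
  · have hn : ‖WithLp.toLp 2 x‖ = √(∑ i, x i ^ 2) := by
      rw [EuclideanSpace.norm_eq]
      simp
    have hn0 : ‖WithLp.toLp 2 x‖ ≠ 0 := norm_ne_zero_iff.2 h
    refine ⟨⟨‖WithLp.toLp 2 x‖⁻¹ • WithLp.toLp 2 x, ?_⟩, fun i => ?_⟩
    · rw [mem_sphere_zero_iff_norm, norm_smul, norm_inv, norm_norm, inv_mul_cancel₀ hn0]
    · simp only [PiLp.smul_apply, smul_eq_mul, ← hn]
      rw [mul_inv_cancel_left₀ hn0]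

/-- Integer vectors matching the moments of degree `2 * s` of the sphere yield an antipodal
design once each direction is repeated according to the `2 * s`-th power of the length. -/
theorem exists_unweighted_design_of_integer_vectors {t s d : ℕ} (hst : t ≤ 2 * s + 1)
    (hd : 1 ≤ d) {R : Type} [Fintype R] (x : R → Fin d → ℤ) (A : ℝ) (hA : A ≠ 0)
    (hx : ∀ α : Fin d →₀ ℕ, α.degree = 2 * s → ∑ r, ∏ i, (x r i : ℝ) ^ α i =
      A * ∫ u, ∏ i, (u : EuclideanSpace ℝ (Fin d)) i ^ α i ∂sphereMeasure d) :
    ∃ X : Multiset (UnitSphere d), IsUnweightedSphericalDesign t X ∧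
      {u | u ∈ X}.ncard ≤ 2 * Fintype.card R := by
  classical
  have := isProbabilityMeasure_sphereMeasure d hd
  obtain ⟨κ, -, hκ⟩ := exists_integral_sphereMeasure_monomial d hd
  choose u hu using fun r => exists_unitSphere_smul hd fun i => (x r i : ℝ)
  set ρ : R → ℝ := fun r => √(∑ i, (x r i : ℝ) ^ 2) with hρ
  have hρ2 : ∀ r, ρ r ^ 2 = ∑ i, (x r i : ℝ) ^ 2 := fun r =>
    Real.sq_sqrt (Finset.sum_nonneg fun i _ => sq_nonneg _)
  -- Multiplicity `‖x r‖ ^ (2 * s)`: a zero vector gets weight `0` if `s > 0`, and `1` if `s = 0`,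
  -- where its direction is arbitrary.
  set n : R → ℕ := fun r => (∑ i, (x r i).natAbs ^ 2) ^ s with hn
  have hnρ : ∀ r, (n r : ℝ) = ρ r ^ (2 * s) := fun r => by
    rw [pow_mul, hρ2]
    simp only [hn]
    push_cast
    simp [Nat.cast_natAbs]
  have hxpoly : ∀ f : MvPolynomial (Fin d) ℝ, f.IsHomogeneous (2 * s) →
      ∑ r, MvPolynomial.eval (fun i => (x r i : ℝ)) f =
        A * ∫ u, polyValue f u ∂sphereMeasure d := by
    intro f hf
    simp only [MvPolynomial.eval_eq']
    rw [Finset.sum_comm, integral_polyValue hd, Finset.mul_sum]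
    refine Finset.sum_congr rfl fun α hα => ?_
    rw [← Finset.mul_sum, hx α, mul_left_comm]
    by_contra hne
    exact (MvPolynomial.mem_support_iff.1 hα) (hf.coeff_eq_zero hne)
  have hmono : ∀ α : Fin d →₀ ℕ, α.degree ≤ t →
      ∑ r, (n r : ℝ) * (∏ i, (u r : EuclideanSpace ℝ (Fin d)) i ^ α i +
        ∏ i, ((-u r : UnitSphere d) : EuclideanSpace ℝ (Fin d)) i ^ α i) =
      2 * A * ∫ u, ∏ i, (u : EuclideanSpace ℝ (Fin d)) i ^ α i ∂sphereMeasure d := by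
    intro α hα
    have hneg : ∀ r, ∏ i, ((-u r : UnitSphere d) : EuclideanSpace ℝ (Fin d)) i ^ α i =
        (-1) ^ α.degree * ∏ i, (u r : EuclideanSpace ℝ (Fin d)) i ^ α i := by
      intro r
      rw [Finsupp.degree_eq_sum, ← Finset.prod_pow_eq_pow_sum, ← Finset.prod_mul_distrib]
      refine Finset.prod_congr rfl fun i _ => ?_
      rw [← mul_pow]
      simp
    simp only [hneg]
    rcases Nat.even_or_odd' α.degree with ⟨j, hj | hj⟩
    · have hjs : s - j + j = s := by omega
      -- Multiplying by a power of `∑ X i ^ 2`, which is `1` on the sphere, raises the degree `2 *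
      -- j` to `2 * s`.
      have hf := hxpoly ((∑ i, MvPolynomial.X i ^ 2) ^ (s - j) * MvPolynomial.monomial α 1) (by
        have h1 : (∑ i : Fin d, MvPolynomial.X i ^ 2 : MvPolynomial (Fin d) ℝ).IsHomogeneous 2 :=
          MvPolynomial.IsHomogeneous.sum _ _ _ fun i _ => MvPolynomial.isHomogeneous_X_pow i 2
        convert! (h1.pow (s - j)).mul (MvPolynomial.isHomogeneous_monomial (1 : ℝ) hj) using 1
        omega)
      have hsphere : ∀ v : UnitSphere d,
          polyValue ((∑ i, MvPolynomial.X i ^ 2) ^ (s - j) * MvPolynomial.monomial α 1) v =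
            ∏ i, (v : EuclideanSpace ℝ (Fin d)) i ^ α i := by
        intro v
        have hv : ∑ i, (v : EuclideanSpace ℝ (Fin d)) i ^ 2 = 1 := by
          rw [← EuclideanSpace.real_norm_sq_eq, norm_eq_of_mem_sphere v, one_pow]
        simp [polyValue, MvPolynomial.eval_monomial, Finsupp.prod_fintype, hv]
      simp only [hsphere] at hf
      rw [mul_assoc, ← hf, Finset.mul_sum]
      refine Finset.sum_congr rfl fun r _ => ?_
      have hxr : ∏ i, (x r i : ℝ) ^ α i =
          ρ r ^ (2 * j) * ∏ i, (u r : EuclideanSpace ℝ (Fin d)) i ^ α i := by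
        rw [← hj, Finsupp.degree_eq_sum, ← Finset.prod_pow_eq_pow_sum,
          ← Finset.prod_mul_distrib]
        refine Finset.prod_congr rfl fun i _ => ?_
        rw [← mul_pow, ← hu]
      have hpow : ρ r ^ (2 * s) = (ρ r ^ 2) ^ (s - j) * ρ r ^ (2 * j) := by
        rw [← pow_mul, ← pow_add]
        congr 1
        omega
      rw [hnρ, hpow, hρ2, hj]
      simp only [map_mul, map_pow, map_sum, MvPolynomial.eval_X, MvPolynomial.eval_monomial,
        one_mul, Finsupp.prod_fintype _ _ fun _ => pow_zero _, hxr]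
      rw [pow_mul]
      norm_num
      ring
    · have hodd : ∃ i, Odd (α i) := by
        by_contra! hev
        have : Even α.degree := by
          rw [Finsupp.degree_eq_sum]
          exact Finset.even_sum _ fun i _ => Nat.not_odd_iff_even.1 (hev i)
        rw [hj] at this
        exact Nat.not_even_two_mul_add_one j this
      obtain ⟨i, hi⟩ := hodd
      rw [hκ, Finset.prod_eq_zero (Finset.mem_univ i) (gaussianMoment_of_odd hi), hj]
      simp [pow_succ]
  set X : Multiset (UnitSphere d) := ∑ r, n r • ({u r} + {-u r}) with hX
  have hsum : ∀ f : UnitSphere d → ℝ,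
      (X.map f).sum = ∑ r, (n r : ℝ) * (f (u r) + f (-u r)) := by
    intro f
    rw [hX, ← Multiset.coe_mapAddMonoidHom, map_sum, ← Multiset.coe_sumAddMonoidHom, map_sum]
    refine Finset.sum_congr rfl fun r _ => ?_
    rw [map_nsmul, map_nsmul]
    simp [mul_add]
  have hpoly : ∀ f : MvPolynomial (Fin d) ℝ, f.totalDegree ≤ t →
      (X.map (polyValue f)).sum = 2 * A * ∫ v, polyValue f v ∂sphereMeasure d := by
    intro f hf
    rw [hsum, integral_polyValue hd, Finset.mul_sum]
    simp only [polyValue_eq_sum, ← Finset.sum_add_distrib, Finset.mul_sum]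
    rw [Finset.sum_comm]
    refine Finset.sum_congr rfl fun α hα => ?_
    have hdeg : α.degree ≤ t := by
      refine le_trans ?_ hf
      rw [Finsupp.degree_eq_sum, ← Finsupp.sum_fintype α (fun _ k => k) fun _ => rfl]
      exact MvPolynomial.le_totalDegree hα
    rw [mul_left_comm, ← hmono α hdeg, Finset.mul_sum]
    exact Finset.sum_congr rfl fun r _ => by ring
  -- The constant polynomial `1` identifies the normalization `2 * A` as the number of points.
  have hcard : (Multiset.card X : ℝ) = 2 * A := by
    have h := hpoly 1 (by simp)
    have h1 : polyValue (1 : MvPolynomial (Fin d) ℝ) = fun _ => 1 := by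
      ext v
      simp [polyValue]
    simpa [h1] using h
  have hX0 : X ≠ 0 := by
    intro h0
    rw [h0] at hcard
    simp [hA] at hcard
  refine ⟨X, ⟨hX0, fun f hf => ?_⟩, ?_⟩
  · rw [hpoly f hf, hcard]
    field_simp
  · have hsub : {v | v ∈ X} ⊆
        ((Finset.univ.image u ∪ Finset.univ.image fun r => -u r : Finset (UnitSphere d)) :
          Set (UnitSphere d)) := by
      intro v hv
      obtain ⟨r, -, hr⟩ := Multiset.mem_sum.1 (hX ▸ hv : v ∈ ∑ r, n r • ({u r} + {-u r}))
      have := Multiset.mem_of_mem_nsmul hr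
      simp only [Multiset.mem_add, Multiset.mem_singleton] at this
      rcases this with rfl | rfl <;> simp
    refine (Set.ncard_le_ncard hsub (Finset.finite_toSet _)).trans ?_
    rw [Set.ncard_coe_finset, two_mul]
    exact (Finset.card_union_le _ _).trans
      (Nat.add_le_add Finset.card_image_le Finset.card_image_le)

/-! ### Assembly. -/

theorem exists_integer_vectors_matching_sphere_moments (s n : ℕ) (hs : 2 * s ≤ n + 1) :
    ∃ p : ℕ, ∀ d : ℕ, 1 ≤ d → ∃ (R : Type) (_ : Fintype R) (x : R → Fin d → ℤ) (A : ℝ),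
      A ≠ 0 ∧ Fintype.card R ≤ p * (p * d) ^ n ∧
      ∀ α : Fin d →₀ ℕ, α.degree = 2 * s → ∑ r, ∏ i, (x r i : ℝ) ^ α i =
        A * ∫ u, ∏ i, (u : EuclideanSpace ℝ (Fin d)) i ^ α i ∂sphereMeasure d := by
  obtain ⟨σ, N, hσ, hg⟩ := exists_equal_weight_quadrature (2 * s)
  obtain ⟨p, hpN, hp⟩ := Nat.exists_infinite_primes N
  obtain ⟨g, hg⟩ := hg p hpN
  have : Fact p.Prime := ⟨hp⟩
  have hp0 : (p : ℝ) ≠ 0 := by exact_mod_cast hp.ne_zero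
  have hσ0 : (σ : ℝ) ≠ 0 := by exact_mod_cast hσ.ne'
  refine ⟨p, fun d hd => ?_⟩
  obtain ⟨κ, hκ0, hκ⟩ := exists_integral_sphereMeasure_monomial d hd
  obtain ⟨R, _, h, hR, hRle, hOA⟩ := exists_orthogonal_array p n d hd
  let e : ZMod p ≃ Fin p := (ZMod.finEquiv p).symm.toEquiv
  refine ⟨R, inferInstance, fun r i => g (e (h r i)),
    Fintype.card R * (σ : ℝ) ^ (2 * s) * (κ (2 * s))⁻¹, ?_, hRle, fun α hα => ?_⟩
  · have : (Fintype.card R : ℝ) ≠ 0 := by exact_mod_cast hR.ne'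
    exact mul_ne_zero (mul_ne_zero this (pow_ne_zero _ hσ0)) (inv_ne_zero (hκ0 _))
  · have hle : ∀ i, α i ≤ 2 * s := fun i => hα ▸ Finsupp.le_degree i α
    -- A monomial of degree `2 * s` involves at most `2 * s ≤ n + 1` variables, so strength `n + 1`
    -- suffices.
    have hsupp : α.support.card ≤ n + 1 := by
      refine le_trans ?_ (hα.trans_le hs)
      rw [Finset.card_eq_sum_ones, Finsupp.degree_apply]
      exact Finset.sum_le_sum fun i hi => Nat.one_le_iff_ne_zero.2 (Finsupp.mem_support_iff.1 hi)
    rw [hOA α.support hsupp (fun i b => (g (e b) : ℝ) ^ α i) fun i hi => by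
      ext b
      simp [Finsupp.notMem_support_iff.1 hi]]
    have hfac : ∀ i, (∑ b, (g (e b) : ℝ) ^ α i) / p =
        (σ : ℝ) ^ α i * gaussianMoment (α i) := by
      intro i
      rw [e.sum_comp fun b => (g b : ℝ) ^ α i, hg _ (hle i), mul_div_cancel_left₀ _ hp0]
    simp only [hfac]
    rw [Finset.prod_mul_distrib, Finset.prod_pow_eq_pow_sum, ← Finsupp.degree_eq_sum, hκ, hα]
    have := hκ0 (2 * s)
    field_simp

/-- The weighted design obtained from an unweighted one by using multiplicities as weights. -/
theorem IsUnweightedSphericalDesign.exists_weighted {d t : ℕ} {X : Multiset (UnitSphere d)}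
    (hX : IsUnweightedSphericalDesign t X) :
    ∃ (Y : Finset (UnitSphere d)) (w : UnitSphere d → ℝ),
      IsWeightedSphericalDesign t Y w ∧ Y.card = {x | x ∈ X}.ncard := by
  classical
  have hc : 0 < (Multiset.card X : ℝ) := by
    exact_mod_cast Multiset.card_pos.2 hX.1
  refine ⟨X.toFinset, fun x => X.count x / Multiset.card X, ⟨fun x hx => ?_, fun f hf => ?_⟩, ?_⟩
  · exact div_pos (by exact_mod_cast Multiset.count_pos.2 (Multiset.mem_toFinset.1 hx)) hc
  · rw [← hX.2 f hf, Finset.sum_multiset_map_count, Finset.mul_sum]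
    refine Finset.sum_congr rfl fun x _ => ?_
    rw [nsmul_eq_mul]
    ring
  · rw [← Set.ncard_coe_finset]
    congr 1
    ext x
    simp

theorem mainTheorem3 (t : ℕ) (ht : 1 ≤ t) :
    ∃ C : ℝ, ∀ d : ℕ, 1 ≤ d →
      (∃ (X : Finset (UnitSphere d)) (w : UnitSphere d → ℝ),
        IsWeightedSphericalDesign t X w ∧ (X.card : ℝ) ≤ C * (d : ℝ) ^ (t - 1)) ∧
      (∃ X : Multiset (UnitSphere d),
        IsUnweightedSphericalDesign t X ∧
          ({x | x ∈ X}.ncard : ℝ) ≤ C * (d : ℝ) ^ (t - 1)) := by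
  -- With `s = t / 2` one has `2 * s ≤ t ≤ 2 * s + 1`: the first bound allows strength `t`, the
  -- second reaches degree `t` by antipodality.
  obtain ⟨p, hp⟩ := exists_integer_vectors_matching_sphere_moments (t / 2) (t - 1) (by omega)
  refine ⟨2 * p ^ t, fun d hd => ?_⟩
  obtain ⟨R, _, x, A, hA, hR, hx⟩ := hp d hd
  obtain ⟨X, hX, hXcard⟩ :=
    exists_unweighted_design_of_integer_vectors (t := t) (by omega) hd x A hA hx
  have hbound : ({x | x ∈ X}.ncard : ℝ) ≤ 2 * p ^ t * (d : ℝ) ^ (t - 1) := by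
    have h : {x | x ∈ X}.ncard ≤ 2 * p ^ t * d ^ (t - 1) := by
      refine hXcard.trans ((Nat.mul_le_mul_left 2 hR).trans_eq ?_)
      rw [mul_pow, ← mul_assoc p, ← pow_succ', Nat.sub_add_cancel ht, mul_assoc]
    exact_mod_cast h
  obtain ⟨Y, w, hY, hYcard⟩ := hX.exists_weighted
  exact ⟨⟨Y, w, hY, by rw [hYcard]; exact hbound⟩, X, hX, hbound⟩
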